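/- Consider the $K$-user additive white Gaussian noise broadcast channel with noisy feedback. In a block of length $L$ the transmitter sends $\mathbf x\in\mathbb R^L$, receiver $i$ observes $\mathbf y_i=\mathbf x+\mathbf z_i$, and the feedback link of receiver $i$ adds the noise $\mathbf n_i$, where all coordinates of $\mathbf z_i$ and $\mathbf n_i$, $1\le i\le K$, are independent, those of $\mathbf z_i$ are $\mathcal N(0,\sigma_{z_i}^2)$ and those of $\mathbf n_i$ are $\mathcal N(0,\sigma_{n_i}^2)$. A linear feedback code of blocklength $L$ with rate tuple $(R_1,\dots,R_K)$, $R_i\ge 0$, maps independent uniformly distributed messages $W_i$, independent of the noises, injectively to message points $\theta_i\in\Theta_i\subset\mathbb R$ with $|\Theta_i|=\lceil 2^{LR_i}\rceil$, and transmits $$\mathbf x=\sum_{i=1}^K\bigl[\mathbf g_i\theta_i+\mathbf F_i(\mathbf z_i+\mathbf n_i)\bigr],$$ where $\mathbf g_i\in\mathbb R^L$ and the $\mathbf F_i\in\mathbb R^{L\times L}$ are lower triangular with zeros on the main diagonal; receiver $i$ decides on its message by a measurable function of a linear estimate $\hat\theta_i=\mathbf q_i^T\mathbf y_i$ with $\mathbf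 q_i\in\mathbb R^L$. The code has to satisfy the power constraint $E[\mathbf x^T\mathbf x]\le LP$, where $P\ge 0$. A linear feedback scheme is a sequence of such codes with a fixed rate tuple, one for each blocklength $L$; a rate $R_k$ is achievable to receiver $k$ if there is a linear feedback scheme whose rate for receiver $k$ is $R_k$ and for which the probability of error at receiver $k$ tends to $0$ as $L\to\infty$. If $\sigma_{z_k}^2>0$ and $\sigma_{n_k}^2>0$, then the only rate that is achievable to receiver $k$ by linear feedback schemes is zero: every linear feedback scheme whose probability of error at receiver $k$ tends to $0$ has $R_k=0$, and the rate $R_k=0$ is achievable. -/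

import Mathlib

open MeasureTheory ProbabilityTheory Filter Topology
open scoped NNReal

namespace AWGNBC

/-- The number of messages at rate `R` and blocklength `L`, i.e. `⌈2 ^ (L R)⌉`. -/
noncomputable def numMessages (R : ℝ) (L : ℕ) : ℕ := ⌈(2 : ℝ) ^ ((L : ℝ) * R)⌉₊

/-- A linear feedback code of blocklength `L` for the `K`-user broadcast channel, with `M k`
messages for receiver `k`. -/
structure LinearFeedbackCode (K L : ℕ) (M : Fin K → ℕ) where
  /-- the map from the messages for receiver `k` to message points -/
  point : ∀ k, Fin (M k) → ℝ
  /-- the messages for a receiver have distinct message points, so that `|Θ_k| = M k` -/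
  point_injective : ∀ k, Function.Injective (point k)
  /-- the vectors `g_k` -/
  g : Fin K → Fin L → ℝ
  /-- the matrices `F_k` acting on the noises seen through the feedback links -/
  F : Fin K → Matrix (Fin L) (Fin L) ℝ
  /-- causality: `F_k` is lower triangular with zeros on the main diagonal -/
  F_causal : ∀ k, ∀ i j : Fin L, i ≤ j → F k i j = 0
  /-- the vectors `q_k` with which the receivers combine their observations -/
  q : Fin K → Fin L → ℝ
  /-- the decision of receiver `k` on its message, from the linear estimate of its message point -/
  dec : ∀ k, ℝ → Fin (M k)
  dec_measurable : ∀ k, Measurable (dec k)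

/-- An outcome of one block of transmission: the messages, the forward noises `z_k[ℓ]`, and the
feedback noises `n_k[ℓ]`. -/
abbrev Outcome (K L : ℕ) (M : Fin K → ℕ) : Type :=
  (∀ k, Fin (M k)) × (Fin K → Fin L → ℝ) × (Fin K → Fin L → ℝ)

/-- The law of an outcome: all messages and noise samples are independent, the messages are
uniform, `z_k[ℓ] ∼ N(0, vz k)` and `n_k[ℓ] ∼ N(0, vn k)`. -/
noncomputable def outcomeLaw (K L : ℕ) (M : Fin K → ℕ) (vz vn : Fin K → ℝ≥0) :
    Measure (Outcome K L M) :=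
  (Measure.pi fun k => uniformOn (Set.univ : Set (Fin (M k)))).prod
    ((Measure.pi fun k => Measure.pi fun _ : Fin L => gaussianReal 0 (vz k)).prod
      (Measure.pi fun k => Measure.pi fun _ : Fin L => gaussianReal 0 (vn k)))

namespace LinearFeedbackCode

variable {K L : ℕ} {M : Fin K → ℕ}

/-- The channel input `x = ∑ k, (g_k θ_k + F_k (z_k + n_k))`. -/
noncomputable def input (C : LinearFeedbackCode K L M) (ω : Outcome K L M) : Fin L → ℝ :=
  ∑ k, (C.point k (ω.1 k) • C.g k + (C.F k).mulVec (ω.2.1 k + ω.2.2 k))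

/-- The channel output `y_k = x + z_k` at receiver `k`. -/
noncomputable def output (C : LinearFeedbackCode K L M) (ω : Outcome K L M) (k : Fin K) :
    Fin L → ℝ :=
  C.input ω + ω.2.1 k

/-- The linear estimate `q_k^T y_k` of the message point at receiver `k`. -/
noncomputable def estimate (C : LinearFeedbackCode K L M) (ω : Outcome K L M) (k : Fin K) : ℝ :=
  C.q k ⬝ᵥ C.output ω k

/-- The average transmit power constraint `E[∑ ℓ, x[ℓ]^2] ≤ L P`. -/
def PowerConstraint (C : LinearFeedbackCode K L M) (vz vn : Fin K → ℝ≥0) (P : ℝ) : Prop :=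
  ∫ ω, ∑ l, (C.input ω l) ^ 2 ∂(outcomeLaw K L M vz vn) ≤ L * P

/-- The probability that receiver `k` decides for a wrong message. -/
noncomputable def errorProb (C : LinearFeedbackCode K L M) (vz vn : Fin K → ℝ≥0) (k : Fin K) : ℝ :=
  (outcomeLaw K L M vz vn).real {ω | C.dec k (C.estimate ω k) ≠ ω.1 k}

end LinearFeedbackCode

/-- A linear feedback scheme with rate tuple `R`: a linear feedback code for every blocklength,
with `⌈2 ^ (L R_k)⌉` messages for receiver `k`. -/
abbrev LinearFeedbackScheme (K : ℕ) (R : Fin K → ℝ) : Type :=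
  ∀ L : ℕ, LinearFeedbackCode K L (fun k => numMessages (R k) L)

/-- The rate `r` is achievable to receiver `k` by linear feedback schemes over the channel with
forward noise variances `vz`, feedback noise variances `vn` and power constraint `P`. Nothing is
required of the error probabilities of the other receivers. -/
def IsAchievableTo {K : ℕ} (vz vn : Fin K → ℝ≥0) (P : ℝ) (k : Fin K) (r : ℝ) : Prop :=
  ∃ R : Fin K → ℝ, (∀ i, 0 ≤ R i) ∧ R k = r ∧
    ∃ S : LinearFeedbackScheme K R,
      (∀ L, (S L).PowerConstraint vz vn P) ∧
        Tendsto (fun L => (S L).errorProb vz vn k) atTop (𝓝 0)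

end AWGNBC

/-! ### Gaussian measures and deciding among points in Gaussian noise. -/

namespace ProbabilityTheory

open scoped ENNReal

/-! For each code the signal-to-noise ratio of receiver `k`'s scalar estimate grows at most linearly
in `L`, while a positive rate needs exponentially many message points. Write `a = F_kᵀ q` and freeze
the other messages. By Cauchy–Schwarz and the power constraint (`signal_le`), the part of the
estimate carrying `θ_k` has variance at most `|q|² L P`. The noise `z_k` enters through `q + a` and
`n_k` through `a`, so the noise variance is at least `vz |q + a|² + vn |a|² ≥ c |q|²` with `c = vz
vn / (vz + vn)`, whatever `F_k` is (`noise_power_ge`). The ratio is thus at most `L P / c`. A scalar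
observation with ratio `B` separates only `O(√(1 + B))` points: Chebyshev puts it in an interval of
length `O(√((1 + B) v))` with probability at least `1/2`, and the Gaussian density is `O(1/√v)`
(`prob_correct_le`). Hence the error probability is at least `1/2 - 2 √(1 + L P / c) / M`
(`le_errorProb`), which tends to `1/2` when `M ≥ 2 ^ (L R)` with `R > 0`. -/

instance isGaussian_pi {ι : Type*} [Fintype ι] {E : ι → Type*} [∀ i, NormedAddCommGroup (E i)]
    [∀ i, NormedSpace ℝ (E i)] [∀ i, MeasurableSpace (E i)] [∀ i, BorelSpace (E i)]
    [∀ i, CompleteSpace (E i)] [∀ i, SecondCountableTopology (E i)]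
    (μ : ∀ i, Measure (E i)) [∀ i, IsGaussian (μ i)] : IsGaussian (Measure.pi μ) := by
  have h : HasGaussianLaw (fun ω : ∀ i, E i => fun i => ω i) (Measure.pi μ) := by
    refine iIndepFun.hasGaussianLaw (X := fun i (ω : ∀ i, E i) => ω i) (fun i => ⟨?_⟩)
      (iIndepFun_pi (X := fun i (x : E i) => x) fun i => aemeasurable_id)
    have := (measurePreserving_eval μ i).map_eq
    rw [show (fun ω : ∀ i, E i => ω i) = Function.eval i from rfl, this]
    infer_instance
  simpa using h.isGaussian_map

theorem lintegral_uniformOn_univ {α : Type*} [Fintype α] [MeasurableSpace α]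
    [MeasurableSingletonClass α] (f : α → ℝ≥0∞) :
    ∫⁻ a, f a ∂(uniformOn (Set.univ : Set α)) = (∑ a, f a) / Fintype.card α := by
  rw [uniformOn, cond, lintegral_smul_measure, Measure.restrict_univ, lintegral_count,
    tsum_fintype]
  simp [ENNReal.div_eq_inv_mul]

theorem gaussianPDF_le (μ : ℝ) (v : ℝ≥0) (x : ℝ) :
    gaussianPDF μ v x ≤ ENNReal.ofReal (√(2 * Real.pi * v))⁻¹ := by
  refine ENNReal.ofReal_le_ofReal ?_
  rw [gaussianPDFReal]
  refine mul_le_of_le_one_right (by positivity) (Real.exp_le_one_iff.2 ?_)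
  exact div_nonpos_of_nonpos_of_nonneg (by nlinarith [sq_nonneg (x - μ)]) (by positivity)

theorem gaussianReal_le_volume (μ : ℝ) {v : ℝ≥0} (hv : v ≠ 0) (s : Set ℝ) :
    gaussianReal μ v s ≤ ENNReal.ofReal (√(2 * Real.pi * v))⁻¹ * volume s := by
  rw [gaussianReal_apply μ hv]
  calc ∫⁻ x in s, gaussianPDF μ v x
      ≤ ∫⁻ _ in s, ENNReal.ofReal (√(2 * Real.pi * v))⁻¹ :=
        lintegral_mono fun x => gaussianPDF_le μ v x
    _ = _ := by simp

/-- Deciding among `M` real points seen in Gaussian noise: the part of the probability of a correct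
decision that comes from observations in an interval is inversely proportional to `M`. -/
theorem prob_correct_near_le {M : ℕ} (s : Fin M → ℝ) (μ : ℝ) {v : ℝ≥0} (hv : v ≠ 0)
    (D : ℝ → Fin M) (hD : Measurable D) (e t : ℝ) :
    ((uniformOn (Set.univ : Set (Fin M))).prod (gaussianReal μ v))
        {p | D (s p.1 + p.2) = p.1 ∧ |s p.1 + p.2 - e| < t} ≤
      ENNReal.ofReal (√(2 * Real.pi * v))⁻¹ * ENNReal.ofReal (2 * t) / M := by
  have hs : Measurable s := measurable_of_finite s
  have hmeas : MeasurableSet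
      {p : Fin M × ℝ | D (s p.1 + p.2) = p.1 ∧ |s p.1 + p.2 - e| < t} := by
    have h1 : Measurable fun p : Fin M × ℝ => s p.1 + p.2 := by fun_prop
    exact (measurableSet_eq_fun (hD.comp h1) measurable_fst).inter
      (measurableSet_lt (h1.sub_const e).abs measurable_const)
  rw [Measure.prod_apply hmeas, lintegral_uniformOn_univ, Fintype.card_fin]
  refine ENNReal.div_le_div_right ?_ _
  have hset (m : Fin M) : MeasurableSet (D ⁻¹' {m} ∩ Metric.ball e t) :=
    (hD (measurableSet_singleton m)).inter measurableSet_ball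
  calc ∑ m, gaussianReal μ v (Prod.mk m ⁻¹' {p | D (s p.1 + p.2) = p.1 ∧ |s p.1 + p.2 - e| < t})
      ≤ ∑ m, ENNReal.ofReal (√(2 * Real.pi * v))⁻¹ * volume (D ⁻¹' {m} ∩ Metric.ball e t) := by
        refine Finset.sum_le_sum fun m _ => ?_
        refine (gaussianReal_le_volume μ hv _).trans_eq ?_
        -- Translation by `s m` turns noise values into observations; the decision regions then
        -- partition the ball, so their volumes add up to its volume.
        rw [← measure_preimage_add volume (s m) (D ⁻¹' {m} ∩ Metric.ball e t)]
        rfl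
    _ = ENNReal.ofReal (√(2 * Real.pi * v))⁻¹ * volume (Metric.ball e t) := by
        rw [← Finset.mul_sum, ← measure_biUnion_finset ?_ fun m _ => hset m]
        · congr 2
          ext y
          simp
        · intro m _ m' _ hmm'
          refine Set.disjoint_left.2 fun y hy hy' => hmm' ?_
          rw [← hy.1, ← hy'.1]
    _ = _ := by rw [Real.volume_ball]

/-- If the variance of `M` equiprobable points is at most `B` times that of the Gaussian noise,
then the probability of a correct decision is at most `1 / 2 + 2 √(1 + B) / M`. -/
theorem prob_correct_le {M : ℕ} [NeZero M] (s : Fin M → ℝ) (μ : ℝ) (v : ℝ≥0)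
    (D : ℝ → Fin M) (hD : Measurable D) {B : ℝ} (hB : 0 ≤ B)
    (hsB : Var[s; uniformOn (Set.univ : Set (Fin M))] ≤ B * v) :
    ((uniformOn (Set.univ : Set (Fin M))).prod (gaussianReal μ v)) {p | D (s p.1 + p.2) = p.1} ≤
      ENNReal.ofReal (1 / 2 + 2 * √(1 + B) / M) := by
  have hs : Measurable s := measurable_of_finite s
  have hM : (0 : ℝ) < M := by exact_mod_cast NeZero.pos M
  have hY : Measurable fun p : Fin M × ℝ => s p.1 + p.2 := by fun_prop
  set U := uniformOn (Set.univ : Set (Fin M)) with hU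
  rcases eq_or_ne v 0 with rfl | hv
  -- Without noise the bound forces all points to coincide, so the decision is a constant guess,
  -- correct with probability `1 / M`.
  · have h0 : Var[s; U] = 0 := le_antisymm (by simpa using hsB) (variance_nonneg _ _)
    have hae := ae_eq_integral_of_variance_eq_zero MemLp.of_discrete h0
    have hcm : MeasurableSet {p : Fin M × ℝ | D (s p.1 + p.2) = p.1} :=
      measurableSet_eq_fun (hD.comp hY) measurable_fst
    rw [Measure.prod_apply hcm]
    calc ∫⁻ m, gaussianReal μ 0 (Prod.mk m ⁻¹' {p | D (s p.1 + p.2) = p.1}) ∂U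
        = ∫⁻ m, (if D (U[s] + μ) = m then 1 else 0) ∂U := by
          refine lintegral_congr_ae ?_
          filter_upwards [hae] with m hm
          have hms : MeasurableSet {x : ℝ | D (s m + x) = m} :=
            (hD.comp (measurable_const_add (s m))) (measurableSet_singleton m)
          rw [gaussianReal_zero_var]
          change Measure.dirac μ {x : ℝ | D (s m + x) = m} = _
          rw [Measure.dirac_apply' _ hms, Set.indicator_apply, ← hm]
          rfl
      _ = 1 / M := by
          rw [hU, lintegral_uniformOn_univ]
          simp
      _ ≤ _ := by
          rw [← ENNReal.ofReal_natCast M, ← ENNReal.ofReal_one, ← ENNReal.ofReal_div_of_pos hM]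
          refine ENNReal.ofReal_le_ofReal ?_
          have : 1 ≤ √(1 + B) := Real.one_le_sqrt.2 (by linarith)
          have : 1 / (M : ℝ) ≤ 2 * √(1 + B) / M := by gcongr; linarith
          linarith
  · have hv' : (0 : ℝ) < v := by exact_mod_cast pos_iff_ne_zero.2 hv
    set Y : Fin M × ℝ → ℝ := fun p => s p.1 + p.2 with hYdef
    set Q := U.prod (gaussianReal μ v) with hQ
    -- The radius for which Chebyshev leaves probability at most `1/2` outside.
    set t := √(2 * ((1 + B) * v)) with ht
    have ht2 : t ^ 2 = 2 * ((1 + B) * v) := Real.sq_sqrt (by positivity)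
    have htpos : 0 < t := Real.sqrt_pos.2 (by positivity)
    have hsL : MemLp s 2 U := MemLp.of_discrete
    have hgL : MemLp (fun x : ℝ => x) 2 (gaussianReal μ v) := IsGaussian.memLp_two_id
    have hYL : MemLp Y 2 Q := (hsL.comp_fst _).add (hgL.comp_snd _)
    have hvar : Var[Y; Q] ≤ (1 + B) * v := by
      rw [hYdef, hQ, variance_add_prod hsL hgL, variance_fun_id_gaussianReal]
      linarith
    have hfar : Q {p | t ≤ |Y p - Q[Y]|} ≤ ENNReal.ofReal (1 / 2) := by
      refine (meas_ge_le_variance_div_sq hYL htpos).trans (ENNReal.ofReal_le_ofReal ?_)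
      rw [ht2, div_le_div_iff₀ (by positivity) two_pos]
      linarith
    have hnear := prob_correct_near_le s μ hv D hD Q[Y] t
    have hbound : ENNReal.ofReal (√(2 * Real.pi * v))⁻¹ * ENNReal.ofReal (2 * t) / M ≤
        ENNReal.ofReal (2 * √(1 + B) / M) := by
      rw [← ENNReal.ofReal_natCast M, ← ENNReal.ofReal_mul (by positivity),
        ← ENNReal.ofReal_div_of_pos hM]
      refine ENNReal.ofReal_le_ofReal ?_
      refine div_le_div_of_nonneg_right ?_ hM.le
      have h1 : t ≤ √(1 + B) * √(2 * Real.pi * v) := by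
        rw [ht, ← Real.sqrt_mul (by positivity)]
        refine Real.sqrt_le_sqrt ?_
        have := Real.pi_gt_three
        have h2 : 0 ≤ (1 + B) * v := by positivity
        nlinarith
      rw [inv_mul_le_iff₀ (by positivity)]
      linarith
    calc Q {p | D (Y p) = p.1}
        ≤ Q ({p | t ≤ |Y p - Q[Y]|} ∪ {p | D (Y p) = p.1 ∧ |Y p - Q[Y]| < t}) := by
          refine measure_mono fun p hp => ?_
          rcases le_or_gt t |Y p - Q[Y]| with h | h
          · exact Or.inl h
          · exact Or.inr ⟨hp, h⟩
      _ ≤ ENNReal.ofReal (1 / 2) + ENNReal.ofReal (2 * √(1 + B) / M) :=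
          (measure_union_le _ _).trans (add_le_add hfar (hnear.trans hbound))
      _ = _ := (ENNReal.ofReal_add (by positivity) (by positivity)).symm

/-- A probability that is uniformly bounded when all but one coordinate is frozen is bounded. -/
theorem lintegral_pi_le_of_update {ι : Type*} [Fintype ι] [DecidableEq ι] {X : ι → Type*}
    [∀ i, MeasurableSpace (X i)] (μ : ∀ i, Measure (X i)) [∀ i, IsProbabilityMeasure (μ i)]
    (i : ι) {f : (∀ i, X i) → ℝ≥0∞} (hf : Measurable f) {c : ℝ≥0∞}
    (h : ∀ x, ∫⁻ t, f (Function.update x i t) ∂(μ i) ≤ c) :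
    ∫⁻ x, f x ∂(Measure.pi μ) ≤ c := by
  refine (lintegral_le_of_lmarginal_le (μ := μ) {i} hf (measurable_const (a := c)) ?_).trans ?_
  · intro x
    simp only [lmarginal_singleton]
    simpa using h x
  · simp

end ProbabilityTheory

/-! ### Message counts and variances of linear functionals of the noises. -/

namespace AWGNBC

theorem numMessages_pos (R : ℝ) (L : ℕ) : 0 < numMessages R L :=
  Nat.ceil_pos.2 (by positivity)

instance (R : ℝ) (L : ℕ) : NeZero (numMessages R L) := ⟨(numMessages_pos R L).ne'⟩

theorem rpow_pow_le_numMessages (R : ℝ) (L : ℕ) : ((2 : ℝ) ^ R) ^ L ≤ numMessages R L := by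
  rw [← Real.rpow_natCast, ← Real.rpow_mul two_pos.le, mul_comm]
  exact Nat.le_ceil _

theorem numMessages_zero (L : ℕ) : numMessages 0 L = 1 := by simp [numMessages]

/-- The law of the noises. -/
noncomputable abbrev noiseLaw (K L : ℕ) (vz vn : Fin K → ℝ≥0) :
    Measure ((Fin K → Fin L → ℝ) × (Fin K → Fin L → ℝ)) :=
  (Measure.pi fun k => Measure.pi fun _ : Fin L => gaussianReal 0 (vz k)).prod
    (Measure.pi fun k => Measure.pi fun _ : Fin L => gaussianReal 0 (vn k))

/-- The linear functional `b^T z`. -/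
noncomputable def dotProductCLM {L : ℕ} (b : Fin L → ℝ) : (Fin L → ℝ) →L[ℝ] ℝ :=
  ∑ l, b l • ContinuousLinearMap.proj l

@[simp]
theorem dotProductCLM_apply {L : ℕ} (b z : Fin L → ℝ) : dotProductCLM b z = b ⬝ᵥ z := by
  simp [dotProductCLM, dotProduct]

/-- The linear functional `∑ k, b_k^T z_k`. -/
noncomputable def sumDotProductCLM {K L : ℕ} (b : Fin K → Fin L → ℝ) :
    (Fin K → Fin L → ℝ) →L[ℝ] ℝ :=
  ∑ k, (dotProductCLM (b k)).comp (ContinuousLinearMap.proj k)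

@[simp]
theorem sumDotProductCLM_apply {K L : ℕ} (b z : Fin K → Fin L → ℝ) :
    sumDotProductCLM b z = ∑ k, b k ⬝ᵥ z k := by
  simp [sumDotProductCLM]

/-- The linear functional `∑ k, b_k^T z_k + ∑ k, a_k^T n_k` of the noises. -/
noncomputable def noiseFunctional {K L : ℕ} (b a : Fin K → Fin L → ℝ) :
    ((Fin K → Fin L → ℝ) × (Fin K → Fin L → ℝ)) →L[ℝ] ℝ :=
  (sumDotProductCLM b).comp (ContinuousLinearMap.fst ℝ _ _) +
    (sumDotProductCLM a).comp (ContinuousLinearMap.snd ℝ _ _)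

theorem noiseFunctional_apply {K L : ℕ} (b a : Fin K → Fin L → ℝ)
    (η : (Fin K → Fin L → ℝ) × (Fin K → Fin L → ℝ)) :
    noiseFunctional b a η = ∑ k, b k ⬝ᵥ η.1 k + ∑ k, a k ⬝ᵥ η.2 k := by
  simp [noiseFunctional]

theorem memLp_sum_dotProduct {K L : ℕ} (b : Fin K → Fin L → ℝ) (v : Fin K → ℝ≥0) :
    MemLp (fun z : Fin K → Fin L → ℝ => ∑ k, b k ⬝ᵥ z k) 2
      (Measure.pi fun k => Measure.pi fun _ : Fin L => gaussianReal 0 (v k)) := by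
  simp only [← sumDotProductCLM_apply]
  exact IsGaussian.memLp_dual _ (sumDotProductCLM b) 2 (by simp)

theorem variance_dotProduct {L : ℕ} (b : Fin L → ℝ) (v : ℝ≥0) :
    Var[fun z : Fin L → ℝ => b ⬝ᵥ z; Measure.pi fun _ : Fin L => gaussianReal 0 v] =
      v * (b ⬝ᵥ b) := by
  have h := variance_sum_pi (μ := fun _ : Fin L => gaussianReal 0 v) (X := fun l x => b l * x)
    fun l => (IsGaussian.memLp_two_id (μ := gaussianReal 0 v)).const_mul (b l)
  rw [show (fun z : Fin L → ℝ => b ⬝ᵥ z) = ∑ l, fun z : Fin L → ℝ => b l * z l by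
    ext z; simp [dotProduct], h]
  simp only [dotProduct, Finset.mul_sum]
  refine Finset.sum_congr rfl fun l _ => ?_
  rw [variance_const_mul, variance_fun_id_gaussianReal]
  ring

theorem variance_sum_dotProduct {K L : ℕ} (b : Fin K → Fin L → ℝ) (v : Fin K → ℝ≥0) :
    Var[fun z : Fin K → Fin L → ℝ => ∑ k, b k ⬝ᵥ z k;
      Measure.pi fun k => Measure.pi fun _ : Fin L => gaussianReal 0 (v k)] =
      ∑ k, v k * (b k ⬝ᵥ b k) := by
  have h := variance_sum_pi (μ := fun k => Measure.pi fun _ : Fin L => gaussianReal 0 (v k))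
    (X := fun k z => b k ⬝ᵥ z) fun k => by
      simp only [← dotProductCLM_apply]
      exact IsGaussian.memLp_dual _ (dotProductCLM (b k)) 2 (by simp)
  rw [show (fun z : Fin K → Fin L → ℝ => ∑ k, b k ⬝ᵥ z k) =
    ∑ k, fun z : Fin K → Fin L → ℝ => b k ⬝ᵥ z k by ext z; simp, h]
  exact Finset.sum_congr rfl fun k _ => variance_dotProduct (b k) (v k)

theorem variance_noiseFunctional {K L : ℕ} (b a : Fin K → Fin L → ℝ) (vz vn : Fin K → ℝ≥0) :
    Var[noiseFunctional b a; noiseLaw K L vz vn] =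
      ∑ k, vz k * (b k ⬝ᵥ b k) + ∑ k, vn k * (a k ⬝ᵥ a k) := by
  rw [show (noiseFunctional b a : _ → ℝ) = fun η => ∑ k, b k ⬝ᵥ η.1 k + ∑ k, a k ⬝ᵥ η.2 k from
    funext (noiseFunctional_apply b a)]
  rw [noiseLaw, variance_add_prod (memLp_sum_dotProduct b vz) (memLp_sum_dotProduct a vn),
    variance_sum_dotProduct, variance_sum_dotProduct]

theorem memLp_noiseFunctional {K L : ℕ} (b a : Fin K → Fin L → ℝ) (vz vn : Fin K → ℝ≥0) :
    MemLp (noiseFunctional b a) 2 (noiseLaw K L vz vn) :=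
  IsGaussian.memLp_dual _ _ 2 (by simp)

instance (K L : ℕ) (M : Fin K → ℕ) [∀ i, NeZero (M i)] (vz vn : Fin K → ℝ≥0) :
    IsProbabilityMeasure (outcomeLaw K L M vz vn) := by
  unfold outcomeLaw
  infer_instance

/-! ### Signal power, noise power and error probability of a single code. -/

namespace LinearFeedbackCode

variable {K L : ℕ} {M : Fin K → ℕ}

theorem input_apply (C : LinearFeedbackCode K L M) (ω : Outcome K L M) (l : Fin L) :
    C.input ω l = ∑ i, C.point i (ω.1 i) * C.g i l +
      noiseFunctional (fun i => C.F i l) (fun i => C.F i l) ω.2 := by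
  simp only [input, noiseFunctional_apply, Finset.sum_apply, Pi.add_apply, Pi.smul_apply,
    smul_eq_mul, Finset.sum_add_distrib, Matrix.mulVec_add]
  rfl

/-- The noise `z_k` reaches receiver `k` both directly and through feedback, `n_k` only through
feedback. This asymmetry is what prevents cancellation. -/
theorem estimate_eq (C : LinearFeedbackCode K L M) (ω : Outcome K L M) (k : Fin K) :
    C.estimate ω k = ∑ i, C.point i (ω.1 i) * (C.q k ⬝ᵥ C.g i) +
      noiseFunctional (fun i => Matrix.vecMul (C.q k) (C.F i) + if i = k then C.q k else 0)
        (fun i => Matrix.vecMul (C.q k) (C.F i)) ω.2 := by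
  simp only [estimate, output, input, noiseFunctional_apply, dotProduct_add, dotProduct_sum,
    dotProduct_smul, smul_eq_mul, Finset.sum_add_distrib, Matrix.mulVec_add,
    Matrix.dotProduct_mulVec, add_dotProduct]
  rw [Finset.sum_congr rfl fun i _ => show
    (if i = k then C.q k else 0) ⬝ᵥ ω.2.1 i = if i = k then C.q k ⬝ᵥ ω.2.1 i else 0 by
      split_ifs <;> simp]
  simp
  ring

/-- The power constraint bounds the power spent on the message points for one receiver. -/
theorem PowerConstraint.signal_le [∀ i, NeZero (M i)] {C : LinearFeedbackCode K L M}
    {vz vn : Fin K → ℝ≥0} {P : ℝ} (h : C.PowerConstraint vz vn P) (k : Fin K) :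
    (C.g k ⬝ᵥ C.g k) * Var[C.point k; uniformOn (Set.univ : Set (Fin (M k)))] ≤ L * P := by
  set U := fun i => uniformOn (Set.univ : Set (Fin (M i)))
  have hsig (l : Fin L) : MemLp (fun w : ∀ i, Fin (M i) => ∑ i, C.point i (w i) * C.g i l) 2
      (Measure.pi U) := MemLp.of_discrete
  have hin (l : Fin L) : (fun ω => C.input ω l) = fun ω : Outcome K L M =>
      (fun w : ∀ i, Fin (M i) => ∑ i, C.point i (w i) * C.g i l) ω.1 +
        noiseFunctional (fun i => C.F i l) (fun i => C.F i l) ω.2 :=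
    funext fun ω => C.input_apply ω l
  have hL (l : Fin L) : MemLp (fun ω => C.input ω l) 2 (outcomeLaw K L M vz vn) := by
    rw [hin]
    exact ((hsig l).comp_fst _).add ((memLp_noiseFunctional _ _ vz vn).comp_snd _)
  have hvar (l : Fin L) : C.g k l ^ 2 * Var[C.point k; U k] ≤
      ∫ ω, C.input ω l ^ 2 ∂(outcomeLaw K L M vz vn) := by
    -- By independence the variance of `x[l]` splits into one term per message plus a noise term;
    -- all but the term of `k` are dropped.
    have h1 := variance_le_expectation_sq (hL l).aestronglyMeasurable
    rw [hin, outcomeLaw, variance_add_prod (hsig l) (memLp_noiseFunctional _ _ vz vn),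
      ← hin, ← outcomeLaw] at h1
    have h2 : Var[fun w : ∀ i, Fin (M i) => ∑ i, C.point i (w i) * C.g i l; Measure.pi U] =
        ∑ i, Var[fun m => C.point i m * C.g i l; U i] := by
      rw [← variance_sum_pi fun i => MemLp.of_discrete]
      congr 1
      ext w
      simp
    have h3 : C.g k l ^ 2 * Var[C.point k; U k] ≤
        ∑ i, Var[fun m => C.point i m * C.g i l; U i] := by
      refine le_trans (le_of_eq ?_) (Finset.single_le_sum
        (f := fun i => Var[fun m => C.point i m * C.g i l; U i])
        (fun i _ => variance_nonneg _ _) (Finset.mem_univ k))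
      rw [variance_mul_const, mul_comm]
    refine h3.trans ((h2.symm.le.trans ?_).trans h1)
    exact le_add_of_nonneg_right (variance_nonneg _ _)
  calc (C.g k ⬝ᵥ C.g k) * Var[C.point k; U k]
      = ∑ l, C.g k l ^ 2 * Var[C.point k; U k] := by
        simp only [dotProduct, Finset.sum_mul, sq]
    _ ≤ ∑ l, ∫ ω, C.input ω l ^ 2 ∂(outcomeLaw K L M vz vn) :=
        Finset.sum_le_sum fun l _ => hvar l
    _ = ∫ ω, ∑ l, C.input ω l ^ 2 ∂(outcomeLaw K L M vz vn) :=
        (integral_finsetSum _ fun l _ => (hL l).integrable_sq).symm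
    _ ≤ L * P := h

/-- Noisy feedback cannot cancel the forward noise: what a combination `q` of the outputs carries
of it has at least `vz vn / (vz + vn)` times the power of `q`. -/
theorem noise_power_ge (C : LinearFeedbackCode K L M) (vz vn : Fin K → ℝ≥0) (k : Fin K)
    (hz : 0 < vz k) :
    (vz k * vn k / (vz k + vn k) : ℝ) * (C.q k ⬝ᵥ C.q k) ≤
      Var[noiseFunctional (fun i => Matrix.vecMul (C.q k) (C.F i) + if i = k then C.q k else 0)
        (fun i => Matrix.vecMul (C.q k) (C.F i)); noiseLaw K L vz vn] := by
  rw [variance_noiseFunctional]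
  have hnn (x : Fin L → ℝ) : 0 ≤ x ⬝ᵥ x := by
    simpa using dotProduct_star_self_nonneg x
  set a := Matrix.vecMul (C.q k) (C.F k) with ha
  set q := C.q k with hq
  have h1 := Finset.single_le_sum (f := fun i => (vz i : ℝ) *
    ((Matrix.vecMul q (C.F i) + if i = k then q else 0) ⬝ᵥ
      (Matrix.vecMul q (C.F i) + if i = k then q else 0)))
    (fun i _ => mul_nonneg (vz i).coe_nonneg (hnn _)) (Finset.mem_univ k)
  have h2 := Finset.single_le_sum (f := fun i => (vn i : ℝ) *
    (Matrix.vecMul q (C.F i) ⬝ᵥ Matrix.vecMul q (C.F i)))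
    (fun i _ => mul_nonneg (vn i).coe_nonneg (hnn _)) (Finset.mem_univ k)
  simp only [if_true, ← ha] at h1 h2
  refine le_trans ?_ (add_le_add h1 h2)
  have hz' : (0 : ℝ) < vz k := hz
  have hn' : (0 : ℝ) ≤ vn k := (vn k).coe_nonneg
  rw [div_mul_eq_mul_div, div_le_iff₀ (by linarith)]
  -- Completing the square: after multiplication by `vz + vn`, the two sides differ by exactly the
  -- squared norm of this vector.
  have h3 := hnn ((vz k : ℝ) • q + ((vz k : ℝ) + vn k) • a)
  simp only [add_dotProduct, dotProduct_add, smul_dotProduct, dotProduct_smul, smul_eq_mul,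
    dotProduct_comm a q] at h3 ⊢
  nlinarith

/-- The probability of error of a linear feedback code is bounded from below in terms of the number
of messages and the signal-to-noise ratio. -/
theorem le_errorProb [∀ i, NeZero (M i)] (C : LinearFeedbackCode K L M) (vz vn : Fin K → ℝ≥0)
    {P : ℝ} (hP : 0 ≤ P) (h : C.PowerConstraint vz vn P) (k : Fin K) (hz : 0 < vz k)
    (hn : 0 < vn k) :
    1 / 2 - 2 * √(1 + L * P / (vz k * vn k / (vz k + vn k))) / M k ≤ C.errorProb vz vn k := by
  have hz' : (0 : ℝ) < vz k := hz
  have hn' : (0 : ℝ) < vn k := hn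
  set c : ℝ := vz k * vn k / (vz k + vn k)
  have hcpos : 0 < c := by positivity
  set W := noiseFunctional
    (fun i => Matrix.vecMul (C.q k) (C.F i) + if i = k then C.q k else 0)
    (fun i => Matrix.vecMul (C.q k) (C.F i))
  set U := fun i => uniformOn (Set.univ : Set (Fin (M i))) with hU
  set ν := noiseLaw K L vz vn with hν
  set sig : (∀ i, Fin (M i)) → ℝ := fun w => ∑ i, C.point i (w i) * (C.q k ⬝ᵥ C.g i) with hsig
  have hlaw : outcomeLaw K L M vz vn = (Measure.pi U).prod ν := rfl
  have hest (ω : Outcome K L M) : C.estimate ω k = sig ω.1 + W ω.2 := C.estimate_eq ω k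
  have hsigm : Measurable sig := measurable_of_finite sig
  have hestm : Measurable fun ω : Outcome K L M => C.estimate ω k := by
    simp only [hest]
    fun_prop
  have hcm : MeasurableSet {ω : Outcome K L M | C.dec k (C.estimate ω k) = ω.1 k} :=
    measurableSet_eq_fun ((C.dec_measurable k).comp hestm) (by fun_prop)
  have hnn (x : Fin L → ℝ) : 0 ≤ x ⬝ᵥ x := by
    simpa using dotProduct_star_self_nonneg x
  have hWν : Var[W; ν] = ((Var[W; ν]).toNNReal : ℝ) :=
    (Real.coe_toNNReal _ (variance_nonneg _ _)).symm
  -- With the other messages frozen they only shift the points, so the variance bound required by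
  -- `prob_correct_le` holds with `B = L P / c`.
  have hscalar (w : ∀ i, Fin (M i)) :
      Var[fun m => sig (Function.update w k m); U k] ≤ L * P / c * (Var[W; ν]).toNNReal := by
    rw [← hWν]
    have h1 : (fun m => sig (Function.update w k m)) = fun m =>
        C.point k m * (C.q k ⬝ᵥ C.g k) +
          ∑ i ∈ Finset.univ.erase k, C.point i (w i) * (C.q k ⬝ᵥ C.g i) := by
      ext m
      rw [hsig]
      simp only
      rw [← Finset.add_sum_erase _ _ (Finset.mem_univ k)]
      congr 1
      · simp
      · refine Finset.sum_congr rfl fun i hi => ?_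
        rw [Function.update_of_ne (Finset.ne_of_mem_erase hi)]
    rw [h1, variance_add_const (by fun_prop), variance_mul_const]
    have hcs : (C.q k ⬝ᵥ C.g k) ^ 2 ≤ (C.q k ⬝ᵥ C.q k) * (C.g k ⬝ᵥ C.g k) := by
      simpa only [dotProduct, sq] using
        Finset.sum_mul_sq_le_sq_mul_sq Finset.univ (C.q k) (C.g k)
    calc Var[C.point k; U k] * (C.q k ⬝ᵥ C.g k) ^ 2
        ≤ Var[C.point k; U k] * ((C.q k ⬝ᵥ C.q k) * (C.g k ⬝ᵥ C.g k)) :=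
          mul_le_mul_of_nonneg_left hcs (variance_nonneg _ _)
      _ = (C.q k ⬝ᵥ C.q k) * ((C.g k ⬝ᵥ C.g k) * Var[C.point k; U k]) := by ring
      _ ≤ (C.q k ⬝ᵥ C.q k) * (L * P) :=
          mul_le_mul_of_nonneg_left (h.signal_le k) (hnn _)
      _ = L * P / c * (c * (C.q k ⬝ᵥ C.q k)) := by field_simp
      _ ≤ L * P / c * Var[W; ν] :=
          mul_le_mul_of_nonneg_left (C.noise_power_ge vz vn k hz) (by positivity)
  have hcorrect : outcomeLaw K L M vz vn {ω | C.dec k (C.estimate ω k) = ω.1 k} ≤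
      ENNReal.ofReal (1 / 2 + 2 * √(1 + L * P / c) / M k) := by
    rw [hlaw, Measure.prod_apply hcm]
    refine lintegral_pi_le_of_update U k (measurable_measure_prodMk_left hcm) fun w => ?_
    have hb := prob_correct_le (fun m => sig (Function.update w k m)) (ν[W])
      (Var[W; ν]).toNNReal (C.dec k) (C.dec_measurable k) (by positivity) (hscalar w)
    have hm : Measurable fun p : Fin (M k) × ℝ => sig (Function.update w k p.1) + p.2 :=
      ((measurable_of_finite fun m => sig (Function.update w k m)).comp measurable_fst).add
        measurable_snd
    have hcm' : MeasurableSet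
        {p : Fin (M k) × ℝ | C.dec k (sig (Function.update w k p.1) + p.2) = p.1} :=
      measurableSet_eq_fun ((C.dec_measurable k).comp hm) measurable_fst
    rw [Measure.prod_apply hcm'] at hb
    refine le_trans (le_of_eq (lintegral_congr fun m => ?_)) hb
    -- The noise enters the decision only through the scalar `W`, which is Gaussian as a linear
    -- functional of a Gaussian vector.
    have hgauss : ν.map W = gaussianReal (ν[W]) (Var[W; ν]).toNNReal :=
      IsGaussian.map_eq_gaussianReal W
    rw [← hgauss, Measure.map_apply (by fun_prop)]
    · congr 1
      ext η
      simp [hest]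
    · exact measurable_prodMk_left hcm'
  have hcompl := probReal_compl_eq_one_sub (μ := outcomeLaw K L M vz vn) hcm
  have hreal : (outcomeLaw K L M vz vn).real {ω | C.dec k (C.estimate ω k) = ω.1 k} ≤
      1 / 2 + 2 * √(1 + L * P / c) / M k :=
    ENNReal.toReal_le_of_le_ofReal (by positivity) hcorrect
  have herr : C.errorProb vz vn k =
      (outcomeLaw K L M vz vn).real {ω | C.dec k (C.estimate ω k) = ω.1 k}ᶜ := rfl
  rw [herr, hcompl]
  linarith

end LinearFeedbackCode

/-! ### Schemes: rate zero and the limit of large blocklength. -/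

theorem isAchievableTo_zero {K : ℕ} (vz vn : Fin K → ℝ≥0) {P : ℝ} (hP : 0 ≤ P) (k : Fin K) :
    IsAchievableTo vz vn P k 0 := by
  have hsub (L : ℕ) : Subsingleton (Fin (numMessages 0 L)) := by
    rw [numMessages_zero]; infer_instance
  -- At rate zero there is a single message, so the silent code never errs.
  refine ⟨fun _ => 0, fun _ => le_rfl, rfl, fun L =>
    { point := fun _ _ => 0
      point_injective := fun _ _ _ _ => Subsingleton.elim _ _
      g := 0
      F := 0
      F_causal := fun _ _ _ _ => rfl
      q := 0
      dec := fun _ _ => 0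
      dec_measurable := fun _ => measurable_const }, fun L => ?_, ?_⟩
  · simp only [LinearFeedbackCode.PowerConstraint, LinearFeedbackCode.input]
    simp
    positivity
  · refine tendsto_const_nhds.congr fun L => ?_
    simp [LinearFeedbackCode.errorProb, Subsingleton.elim _ (0 : Fin (numMessages 0 L))]

theorem IsAchievableTo.eq_zero {K : ℕ} {vz vn : Fin K → ℝ≥0} {P : ℝ} (hP : 0 ≤ P) {k : Fin K}
    (hz : 0 < vz k) (hn : 0 < vn k) {r : ℝ} (h : IsAchievableTo vz vn P k r) : r = 0 := by
  obtain ⟨R, hR, rfl, S, hS, hlim⟩ := h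
  by_contra hne
  have hRpos : 0 < R k := lt_of_le_of_ne (hR k) (Ne.symm hne)
  set c : ℝ := vz k * vn k / (vz k + vn k)
  have hc0 : 0 ≤ c := by positivity
  have hρ : 1 < (2 : ℝ) ^ R k := Real.one_lt_rpow one_lt_two hRpos
  have hbound (L : ℕ) : 1 / 2 - 2 * (1 + L * (P / c)) / ((2 : ℝ) ^ R k) ^ L ≤
      (S L).errorProb vz vn k := by
    refine le_trans ?_ ((S L).le_errorProb vz vn hP (hS L) k hz hn)
    -- The crude bound `√(1 + x) ≤ 1 + x` suffices: the denominator is exponential in `L`.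
    have h1 : √(1 + L * P / c) ≤ 1 + L * (P / c) := by
      rw [← mul_div_assoc]
      have h0 : 0 ≤ L * P / c := by positivity
      exact Real.sqrt_le_iff.2 ⟨by positivity, by nlinarith⟩
    have h2 := rpow_pow_le_numMessages (R k) L
    gcongr
  have h0 := (tendsto_pow_const_div_const_pow_of_one_lt 0 hρ).const_mul 2
  have h1 := (tendsto_pow_const_div_const_pow_of_one_lt 1 hρ).const_mul (2 * (P / c))
  have hvanish : Tendsto (fun L : ℕ => 1 / 2 - 2 * (1 + L * (P / c)) / ((2 : ℝ) ^ R k) ^ L) atTop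
      (𝓝 (1 / 2)) := by
    have h2 := (h0.add h1).const_sub (1 / 2)
    simp only [mul_zero, add_zero, sub_zero] at h2
    refine h2.congr fun L => ?_
    ring
  -- In the limit this reads `1/2 ≤ 0`.
  have := le_of_tendsto_of_tendsto' hvanish hlim hbound
  norm_num at this

end AWGNBC

theorem lemma1 {K : ℕ} (vz vn : Fin K → ℝ≥0) (P : ℝ) (hP : 0 ≤ P) (k : Fin K)
    (hz : 0 < vz k) (hn : 0 < vn k) (r : ℝ) :
    AWGNBC.IsAchievableTo vz vn P k r ↔ r = 0 :=
  ⟨fun h => h.eq_zero hP hz hn, fun h => h ▸ AWGNBC.isAchievableTo_zero vz vn hP k⟩
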